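/- Let $q\ge 1$ and $n\ge 0$ be integers, let $M,K\in\mathbb{R}^{n\times n}$ be symmetric positive definite, and let $D_{ij}\in\mathbb{R}^{n\times n}$ ($i,j=1,\dots,q$) satisfy $D_{ij}=D_{ij}^T=D_{ji}\ge 0$ and $D_{ii}=0$. Consider the purely dissipatively coupled array $$M\ddot x_i+Kx_i+\sum_{j=1}^q D_{ij}(\dot x_i-\dot x_j)=0,\qquad i=1,\dots,q,\quad x_i(t)\in\mathbb{R}^n .$$ The array is said to synchronize if $\|x_i(t)-x_j(t)\|\to 0$ as $t\to\infty$ for all $i,j$ and all solutions (that is, for all initial conditions). Let $P=M^{-1/2}KM^{-1/2}$ and assume that its eigenvalues $\sigma_1,\dots,\sigma_n$ are distinct; let $v_1,\dots,v_n\in\mathbb{R}^n$ be corresponding unit eigenvectors, $Pv_k=\sigma_kv_k$. Let $L_{\rm d}\in\mathbb{R}^{qn\times qn}$ be the matrix-weighted Laplacian with weights $W_{ij}=M^{-1/2}D_{ij}M^{-1/2}$, i.e. the block matrix whose $i$th diagonal block is $\sum_{j}W_{ij}$ and whose $(i,j)$ block for $i\ne j$ is $-W_{ij}$, and put $$G_{kk}=[I_q\otimes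 v_k^T]\,L_{\rm d}\,[I_q\otimes v_k]\in\mathbb{R}^{q\times q},\qquad k=1,\dots,n .$$ Theorem. The array synchronizes if and only if, for every $k=1,\dots,n$, zero is a simple eigenvalue of $G_{kk}$ (algebraic multiplicity one). If $q\ge 2$, the array synchronizes if and only if $\lambda_2(G_{kk})>0$ for all $k=1,\dots,n$, where $\lambda_2(G_{kk})$ denotes the second smallest eigenvalue (counted with multiplicity) of the real symmetric matrix $G_{kk}$. -/

import Mathlib

open scoped Matrix Kronecker MatrixOrder

noncomputable section

namespace SmallOscillations

/-- The inverse square root `M^{-1/2}` of a positive definite matrix `M`, i.e. the inverse of its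
positive semidefinite square root. -/
def invSqrt {n : ℕ} (M : Matrix (Fin n) (Fin n) ℝ) : Matrix (Fin n) (Fin n) ℝ :=
  (CFC.sqrt M)⁻¹

/-- `P = M^{-1/2} K M^{-1/2}`. -/
def normalizedStiffness {n : ℕ} (M K : Matrix (Fin n) (Fin n) ℝ) : Matrix (Fin n) (Fin n) ℝ :=
  invSqrt M * K * invSqrt M

/-- The matrix-weighted Laplacian `lap (W i j)`, a `q × q` block matrix with blocks of size `n × n`:
the diagonal blocks are `∑ l, W i l`, the off-diagonal blocks are `-W i j`. -/
def lap {q n : ℕ} (W : Fin q → Fin q → Matrix (Fin n) (Fin n) ℝ) :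
    Matrix (Fin q × Fin n) (Fin q × Fin n) ℝ :=
  Matrix.of fun r c => if r.1 = c.1 then ∑ l, W r.1 l r.2 c.2 else -W r.1 c.1 r.2 c.2

/-- The dissipative Laplacian `L_d = lap (M^{-1/2} D i j M^{-1/2})`. -/
def dissipativeLaplacian {q n : ℕ} (M : Matrix (Fin n) (Fin n) ℝ)
    (D : Fin q → Fin q → Matrix (Fin n) (Fin n) ℝ) :
    Matrix (Fin q × Fin n) (Fin q × Fin n) ℝ :=
  lap fun i j => invSqrt M * D i j * invSqrt M

/-- The `q × q` matrix `[I_q ⊗ vᵀ] L [I_q ⊗ v]` (with `v` regarded as an `n × 1` column). -/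
def projectedLaplacian {q n : ℕ} (L : Matrix (Fin q × Fin n) (Fin q × Fin n) ℝ)
    (v : Fin n → ℝ) : Matrix (Fin q) (Fin q) ℝ :=
  (((1 : Matrix (Fin q) (Fin q) ℝ) ⊗ₖ Matrix.replicateRow Unit v) * L *
    ((1 : Matrix (Fin q) (Fin q) ℝ) ⊗ₖ Matrix.replicateCol Unit v)).submatrix
      (fun i => (i, ())) (fun i => (i, ()))

theorem length_sort_re_roots {m : ℕ} (X : Matrix (Fin m) (Fin m) ℂ) :
    ((X.charpoly.roots.map Complex.re).sort (· ≤ ·)).length = m := by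
  rw [Multiset.length_sort, Multiset.card_map,
    (Polynomial.splits_iff_card_roots.mp (IsAlgClosed.splits X.charpoly)),
    Matrix.charpoly_natDegree_eq_dim, Fintype.card_fin]

/-- The eigenvalues of `X`, with algebraic multiplicity, are ordered by increasing real part
`Re λ₁ ≤ Re λ₂ ≤ ⋯ ≤ Re λₘ`; `reEigenvalue X k` is `Re λₖ₊₁` (the index `k` starts at `0`). -/
def reEigenvalue {m : ℕ} (X : Matrix (Fin m) (Fin m) ℂ) (k : Fin m) : ℝ :=
  ((X.charpoly.roots.map Complex.re).sort (· ≤ ·)).get (k.cast (length_sort_re_roots X).symm)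

/-- `x` is a solution of the purely dissipatively coupled array
`M ẍᵢ + K xᵢ + ∑ⱼ D i j (ẋᵢ - ẋⱼ) = 0`, where `y = ẋ` and `a = ẍ`. -/
def IsSolution {q n : ℕ} (M K : Matrix (Fin n) (Fin n) ℝ)
    (D : Fin q → Fin q → Matrix (Fin n) (Fin n) ℝ) (x : Fin q → ℝ → Fin n → ℝ) : Prop :=
  ∃ y a : Fin q → ℝ → Fin n → ℝ, ∀ i t,
    HasDerivAt (x i) (y i t) t ∧ HasDerivAt (y i) (a i t) t ∧
      M *ᵥ a i t + K *ᵥ x i t + ∑ j, D i j *ᵥ (y i t - y j t) = 0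

/-- The array synchronizes: `‖xᵢ(t) - xⱼ(t)‖ → 0` (Euclidean norm) as `t → ∞`, for all `i`, `j` and
all solutions, i.e. for all initial conditions. -/
def Synchronizes {q n : ℕ} (M K : Matrix (Fin n) (Fin n) ℝ)
    (D : Fin q → Fin q → Matrix (Fin n) (Fin n) ℝ) : Prop :=
  ∀ x : Fin q → ℝ → Fin n → ℝ, IsSolution M K D x →
    ∀ i j, Filter.Tendsto (fun t => ‖WithLp.toLp 2 (x i t - x j t)‖) Filter.atTop (nhds 0)

end SmallOscillations

end

/-!
The array is a damped oscillator `M ẍ + C ẋ + K x = 0` on `ℝ^(qn)` whose damping matrix `C` is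
the Laplacian of the `D i j`. Its energy is nonincreasing and proper, so by LaSalle's invariance
principle only the motions along which `C ẋ` vanishes identically matter for large times. For
these the units are uncoupled and `D i j (ẋ i - ẋ j) = 0`. The modes of `K u = σ M u` oscillate
at distinct frequencies, so this relation holds separately for every mode: the amplitudes `c i`
of the mode `u k = M^(-1/2) v k` satisfy `(c i - c j) D i j (u k) = 0`, which says precisely
that `c` lies in the kernel of `G k`. If every kernel consists of the constant vectors, all
units therefore agree in the limit. Conversely, a vector `c` in the kernel of `G k` yields the
undamped solution `x i (t) = c i cos(√(σ k) t) u k`, which synchronizes only if `c` is constant.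
-/

namespace SmallOscillations

open Filter Topology Bornology Matrix

section LinearFlow

variable {V : Type*} [NormedAddCommGroup V] [NormedSpace ℝ V]

theorem isIntegralCurve_exp_smul_apply [CompleteSpace V] (A : V →L[ℝ] V) (v : V) :
    IsIntegralCurve (fun t : ℝ => NormedSpace.exp (t • A) v) fun _ => A := fun t => by
  simpa using (hasDerivAt_exp_smul_const' (𝕂 := ℝ) A t).clm_apply (hasDerivAt_const t v)

theorem apply_add_eq_exp_smul_apply [CompleteSpace V] {A : V →L[ℝ] V} {z : ℝ → V}
    (hz : IsIntegralCurve z fun _ => A) (s t : ℝ) :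
    z (s + t) = NormedSpace.exp (t • A) (z s) := by
  have hshift : IsIntegralCurve (fun r => z (s + r)) fun _ => A := fun r =>
    (hz (s + r)).comp_const_add s r
  have heq := ODE_solution_unique_univ (v := fun _ => A) (s := fun _ => Set.univ) (K := ‖A‖₊)
    (t₀ := 0) (fun _ => A.lipschitz.lipschitzOnWith) (fun r => ⟨hshift r, trivial⟩)
    (fun r => ⟨isIntegralCurve_exp_smul_apply A (z s) r, trivial⟩) (by simp)
  exact congrFun heq t

/-- LaSalle's invariance principle for a linear flow: the orbit of a limit point of `z` consists of
limit points of `z`, so the Lyapunov function `E` is constant along it. -/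
theorem tendsto_of_forall_constant_lyapunov [FiniteDimensional ℝ V] {F : Type*}
    [TopologicalSpace F] {A : V →L[ℝ] V} {E : V → ℝ} (hE : Continuous E)
    (hE_coercive : Tendsto E (cobounded V) atTop) {Φ : V → F} (hΦ : Continuous Φ) {c : F}
    (hconst : ∀ w : ℝ → V, IsIntegralCurve w (fun _ => A) → (∀ s t, E (w s) = E (w t)) →
      Φ (w 0) = c)
    {z : ℝ → V} (hz : IsIntegralCurve z fun _ => A) (hanti : Antitone fun t => E (z t)) :
    Tendsto (fun t => Φ (z t)) atTop (𝓝 c) := by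
  have : CompleteSpace V := FiniteDimensional.complete ℝ V
  have : ProperSpace V := FiniteDimensional.proper ℝ V
  have hbdd : IsBounded {v | E v ≤ E (z 0)} := by
    rw [isBounded_def]
    filter_upwards [hE_coercive.eventually_gt_atTop (E (z 0))] with v hv using not_le.mpr hv
  refine tendsto_of_subseq_tendsto fun τ hτ => ?_
  obtain ⟨a, -, φ, hφ, ha⟩ := tendsto_subseq_of_frequently_bounded hbdd (x := z ∘ τ)
    (hτ.eventually_ge_atTop 0 |>.mono fun _ h => hanti h).frequently
  have hτφ : Tendsto (τ ∘ φ) atTop atTop := hτ.comp hφ.tendsto_atTop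
  have hlim : Tendsto (fun t => E (z t)) atTop (𝓝 (E a)) :=
    (tendsto_iff_tendsto_subseq_of_antitone hanti hτφ).mpr ((hE.tendsto a).comp ha)
  have hE_orbit (t : ℝ) : E (NormedSpace.exp (t • A) a) = E a := by
    have hshift : Tendsto (fun k => E (z (τ (φ k) + t))) atTop (𝓝 (E a)) :=
      hlim.comp (tendsto_atTop_add_const_right _ t hτφ)
    simp only [apply_add_eq_exp_smul_apply hz] at hshift
    exact tendsto_nhds_unique
      (((hE.comp (NormedSpace.exp (t • A)).continuous).tendsto a).comp ha) hshift
  have hΦa : Φ a = c := by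
    simpa using hconst _ (isIntegralCurve_exp_smul_apply A a)
      fun s t => (hE_orbit s).trans (hE_orbit t).symm
  exact ⟨φ, hΦa ▸ (hΦ.tendsto a).comp ha⟩

theorem exists_pos_forall_mul_sq_norm_le [FiniteDimensional ℝ V] {f : V → ℝ} (hf : Continuous f)
    (hsmul : ∀ (r : ℝ) v, f (r • v) = r ^ 2 * f v) (hpos : ∀ v ≠ 0, 0 < f v) :
    ∃ c > 0, ∀ v, c * ‖v‖ ^ 2 ≤ f v := by
  have : ProperSpace V := FiniteDimensional.proper ℝ V
  have hf0 : f 0 = 0 := by simpa using hsmul 0 0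
  rcases subsingleton_or_nontrivial V with hV | hV
  · exact ⟨1, one_pos, fun v => by simp [Subsingleton.elim v 0, hf0]⟩
  obtain ⟨u, hu, hmin⟩ := (isCompact_sphere (0 : V) 1).exists_isMinOn
    (NormedSpace.sphere_nonempty.mpr zero_le_one) hf.continuousOn
  refine ⟨f u, hpos u (ne_zero_of_mem_unit_sphere ⟨u, hu⟩), fun v => ?_⟩
  rcases eq_or_ne v 0 with rfl | hv
  · simp [hf0]
  have hnorm : ‖v‖ ≠ 0 := norm_ne_zero_iff.mpr hv
  calc f u * ‖v‖ ^ 2 ≤ f (‖v‖⁻¹ • v) * ‖v‖ ^ 2 := by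
        gcongr
        exact hmin (by simp [norm_smul, hnorm])
    _ = f v := by rw [hsmul]; field_simp

theorem tendsto_cobounded_atTop_of_sq_homogeneous [FiniteDimensional ℝ V] {f : V → ℝ}
    (hf : Continuous f) (hsmul : ∀ (r : ℝ) v, f (r • v) = r ^ 2 * f v)
    (hpos : ∀ v ≠ 0, 0 < f v) : Tendsto f (cobounded V) atTop := by
  obtain ⟨c, hc, hle⟩ := exists_pos_forall_mul_sq_norm_le hf hsmul hpos
  exact tendsto_atTop_mono hle <|
    ((tendsto_pow_atTop two_ne_zero).comp tendsto_norm_cobounded_atTop).const_mul_atTop hc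

end LinearFlow

section DampedMotion

variable {m : Type*} [Fintype m]

theorem hasDerivAt_dotProduct {x y : ℝ → m → ℝ} {x' y' : m → ℝ} {t : ℝ}
    (hx : HasDerivAt x x' t) (hy : HasDerivAt y y' t) :
    HasDerivAt (fun s => x s ⬝ᵥ y s) (x' ⬝ᵥ y t + x t ⬝ᵥ y') t := by
  simp only [dotProduct, ← Finset.sum_add_distrib]
  exact HasDerivAt.fun_sum fun k _ => (hasDerivAt_pi.mp hx k).mul (hasDerivAt_pi.mp hy k)

theorem dotProduct_mulVec_comm {S : Matrix m m ℝ} (hS : S.IsHermitian) (v w : m → ℝ) :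
    v ⬝ᵥ S *ᵥ w = w ⬝ᵥ S *ᵥ v := by
  rw [dotProduct_mulVec, ← mulVec_transpose, ← conjTranspose_eq_transpose_of_trivial, hS.eq,
    dotProduct_comm]

theorem hasDerivAt_mulVec (S : Matrix m m ℝ) {x : ℝ → m → ℝ} {x' : m → ℝ} {t : ℝ}
    (hx : HasDerivAt x x' t) : HasDerivAt (fun s => S *ᵥ x s) (S *ᵥ x') t :=
  S.mulVecLin.toContinuousLinearMap.hasFDerivAt.comp_hasDerivAt t hx

theorem hasDerivAt_dotProduct_mulVec_self {S : Matrix m m ℝ} (hS : S.IsHermitian)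
    {x : ℝ → m → ℝ} {x' : m → ℝ} {t : ℝ} (hx : HasDerivAt x x' t) :
    HasDerivAt (fun s => x s ⬝ᵥ S *ᵥ x s) (2 * (x' ⬝ᵥ S *ᵥ x t)) t :=
  (hasDerivAt_dotProduct hx (hasDerivAt_mulVec S hx)).congr_deriv <| by
    rw [dotProduct_mulVec_comm hS, two_mul]

/-- The motions of the damped linear oscillator `M ẍ + C ẋ + K x = 0`, where `y = ẋ`. -/
def IsDampedMotion (M C K : Matrix m m ℝ) (x y : ℝ → m → ℝ) : Prop :=
  ∀ t, HasDerivAt x (y t) t ∧ ∃ a, HasDerivAt y a t ∧ M *ᵥ a + C *ᵥ y t + K *ᵥ x t = 0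

/-- The vector field `(x, y) ↦ (y, -M⁻¹ (C y + K x))` on phase space, whose integral curves are the
motions of `M ẍ + C ẋ + K x = 0` when `M` is invertible. -/
noncomputable def phaseField [DecidableEq m] (M C K : Matrix m m ℝ) :
    (m → ℝ) × (m → ℝ) →L[ℝ] (m → ℝ) × (m → ℝ) :=
  LinearMap.toContinuousLinearMap <| (LinearMap.snd ℝ _ _).prod <|
    -(M⁻¹.mulVecLin ∘ₗ (C.mulVecLin ∘ₗ LinearMap.snd ℝ _ _ + K.mulVecLin ∘ₗ LinearMap.fst ℝ _ _))

/-- Twice the mechanical energy, kinetic plus potential, of the oscillator at the phase `(x, y)`: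
the Lyapunov function of the damped motions. -/
def energy (M K : Matrix m m ℝ) (z : (m → ℝ) × (m → ℝ)) : ℝ :=
  z.2 ⬝ᵥ M *ᵥ z.2 + z.1 ⬝ᵥ K *ᵥ z.1

variable {M C K : Matrix m m ℝ} {x y : ℝ → m → ℝ}

theorem isDampedMotion_iff_isIntegralCurve [DecidableEq m] (hM : IsUnit M) :
    IsDampedMotion M C K x y ↔
      IsIntegralCurve (fun t => (x t, y t)) fun _ => phaseField M C K := by
  have hdet : IsUnit M.det := (isUnit_iff_isUnit_det M).mp hM
  have hsolve (a b : m → ℝ) : M *ᵥ a + b = 0 ↔ a = -(M⁻¹ *ᵥ b) := by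
    rw [← mulVec_neg]
    constructor
    · intro h
      rw [← eq_neg_of_add_eq_zero_left h, mulVec_mulVec, nonsing_inv_mul _ hdet, one_mulVec]
    · rintro rfl
      rw [mulVec_mulVec, mul_nonsing_inv _ hdet, one_mulVec, neg_add_cancel]
  refine forall_congr' fun t => ?_
  simp only [add_assoc, hsolve, exists_eq_right]
  exact ⟨fun h => h.1.prodMk h.2, fun h => ⟨h.fst, h.snd⟩⟩

theorem hasDerivAt_energy (hM : M.IsHermitian) (hK : K.IsHermitian)
    (h : IsDampedMotion M C K x y) (t : ℝ) :
    HasDerivAt (fun s => energy M K (x s, y s)) (-(2 * (y t ⬝ᵥ C *ᵥ y t))) t := by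
  obtain ⟨hx, a, hy, heq⟩ := h t
  refine ((hasDerivAt_dotProduct_mulVec_self hM hy).add
    (hasDerivAt_dotProduct_mulVec_self hK hx)).congr_deriv ?_
  have hpower := congrArg (y t ⬝ᵥ ·) heq
  have hsymm := dotProduct_mulVec_comm hM a (y t)
  simp only [dotProduct_add, dotProduct_zero] at hpower
  linarith

theorem continuous_energy : Continuous (energy M K) := by
  unfold energy
  fun_prop

theorem energy_pos (hM : M.PosDef) (hK : K.PosDef) {z : (m → ℝ) × (m → ℝ)} (hz : z ≠ 0) :
    0 < energy M K z := by
  have hkin : 0 ≤ z.2 ⬝ᵥ M *ᵥ z.2 := hM.posSemidef.dotProduct_mulVec_nonneg z.2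
  by_cases hz1 : z.1 = 0
  · have hz2 : z.2 ≠ 0 := fun hz2 => hz (Prod.ext hz1 hz2)
    simpa [energy, hz1] using hM.dotProduct_mulVec_pos hz2
  · exact add_pos_of_nonneg_of_pos hkin (hK.dotProduct_mulVec_pos hz1)

theorem tendsto_energy_cobounded_atTop (hM : M.PosDef) (hK : K.PosDef) :
    Tendsto (energy M K) (cobounded _) atTop := by
  refine tendsto_cobounded_atTop_of_sq_homogeneous continuous_energy (fun r z => ?_)
    fun z => energy_pos hM hK
  simp only [energy, Prod.smul_fst, Prod.smul_snd, mulVec_smul, smul_dotProduct, dotProduct_smul,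
    smul_eq_mul]
  ring

theorem mulVec_velocity_eq_zero_of_energy_const (hM : M.IsHermitian) (hK : K.IsHermitian)
    (hC : C.PosSemidef) (h : IsDampedMotion M C K x y)
    (hconst : ∀ s t, energy M K (x s, y s) = energy M K (x t, y t)) (t : ℝ) : C *ᵥ y t = 0 := by
  have hderiv := hasDerivAt_energy hM hK h t
  simp only [hconst _ 0] at hderiv
  have hpower := hderiv.unique (hasDerivAt_const t _)
  exact (hC.dotProduct_mulVec_zero_iff _).mp (by simpa using hpower)

theorem tendsto_of_forall_undissipated (hM : M.PosDef) (hK : K.PosDef) (hC : C.PosSemidef)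
    {F : Type*} [TopologicalSpace F] {Φ : (m → ℝ) → F} (hΦ : Continuous Φ) {c : F}
    (hconst : ∀ x y, IsDampedMotion M 0 K x y → (∀ t, C *ᵥ y t = 0) → Φ (x 0) = c)
    (h : IsDampedMotion M C K x y) : Tendsto (fun t => Φ (x t)) atTop (𝓝 c) := by
  classical
  have hanti : Antitone fun t => energy M K (x t, y t) :=
    antitone_of_hasDerivAt_nonpos (hasDerivAt_energy hM.1 hK.1 h) fun t =>
      neg_nonpos.mpr (mul_nonneg zero_le_two (hC.dotProduct_mulVec_nonneg (y t)))
  refine tendsto_of_forall_constant_lyapunov continuous_energy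
    (tendsto_energy_cobounded_atTop hM hK) (hΦ.comp continuous_fst) (fun w hw hE => ?_)
    ((isDampedMotion_iff_isIntegralCurve hM.isUnit).mp h) hanti
  have hmotion : IsDampedMotion M C K (fun t => (w t).1) fun t => (w t).2 :=
    (isDampedMotion_iff_isIntegralCurve hM.isUnit).mpr hw
  have hC0 := mulVec_velocity_eq_zero_of_energy_const hM.1 hK.1 hC hmotion hE
  exact hconst _ _ (fun t => by simpa only [hC0, zero_mulVec] using hmotion t) hC0

end DampedMotion


section Modes

/-- Differentiating the relation twice multiplies the `k`th term by `-σ k`; as in the proof that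
eigenvectors are independent, this lets one eliminate a term. -/
theorem eq_zero_of_forall_sum_harmonic_eq_zero {ι E : Type*} [NormedAddCommGroup E]
    [NormedSpace ℝ E] {σ : ι → ℝ} (hσ : Function.Injective σ) {f g : ι → ℝ → E}
    (hf : ∀ k t, HasDerivAt (f k) (g k t) t) (hg : ∀ k t, HasDerivAt (g k) (-(σ k • f k t)) t)
    {s : Finset ι} (hsum : ∀ t, ∑ k ∈ s, f k t = 0) : ∀ k ∈ s, ∀ t, f k t = 0 := by
  classical
  induction s using Finset.induction_on generalizing f g with
  | empty => simp
  | insert j s hj ih =>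
    have hsum_g (t : ℝ) : ∑ k ∈ insert j s, g k t = 0 :=
      (HasDerivAt.fun_sum fun k _ => hf k t).unique
        (by simpa only [hsum] using hasDerivAt_const t (0 : E))
    have hsum_σ (t : ℝ) : ∑ k ∈ insert j s, -(σ k • f k t) = 0 :=
      (HasDerivAt.fun_sum fun k _ => hg k t).unique
        (by simpa only [hsum_g] using hasDerivAt_const t (0 : E))
    have heliminated (t : ℝ) : ∑ k ∈ s, (σ k - σ j) • f k t = 0 := by
      have hcomb : ∑ k ∈ insert j s, (σ k - σ j) • f k t = 0 := by
        simp only [sub_smul, Finset.sum_sub_distrib, ← Finset.smul_sum, hsum,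
          neg_eq_zero.mp (Finset.sum_neg_distrib (fun k => σ k • f k t) ▸ hsum_σ t), smul_zero,
          sub_zero]
      simpa [Finset.sum_insert hj] using hcomb
    have hs : ∀ k ∈ s, ∀ t, f k t = 0 := fun k hk t =>
      (smul_eq_zero.mp <| ih (f := fun k t => (σ k - σ j) • f k t)
        (fun k t => (hf k t).const_smul _)
        (fun k t => ((hg k t).const_smul (σ k - σ j)).congr_deriv (by module))
        heliminated k hk t).resolve_left (sub_ne_zero.mpr (hσ.ne (ne_of_mem_of_not_mem hk hj)))
    refine Finset.forall_mem_insert _ _ _ |>.mpr ⟨fun t => ?_, hs⟩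
    simpa [Finset.sum_insert hj, Finset.sum_eq_zero fun k hk => hs k hk t] using hsum t

variable {m : Type*} [Fintype m] {M C K : Matrix m m ℝ} {x y x' y' : ℝ → m → ℝ}

theorem IsDampedMotion.sub (h : IsDampedMotion M C K x y) (h' : IsDampedMotion M C K x' y') :
    IsDampedMotion M C K (fun t => x t - x' t) fun t => y t - y' t := by
  intro t
  obtain ⟨hx, a, hy, heq⟩ := h t
  obtain ⟨hx', a', hy', heq'⟩ := h' t
  refine ⟨hx.sub hx', a - a', hy.sub hy', ?_⟩
  simp only [mulVec_sub]
  rw [← sub_eq_zero_of_eq (heq.trans heq'.symm)]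
  abel

theorem IsDampedMotion.eq_zero_of_velocity_eq_zero [DecidableEq m] (hK : IsUnit K)
    (h : IsDampedMotion M C K x y) (hy : ∀ t, y t = 0) (t : ℝ) : x t = 0 := by
  obtain ⟨-, a, hya, heq⟩ := h t
  have ha : a = 0 := hya.unique (by simpa only [funext hy] using hasDerivAt_const t (0 : m → ℝ))
  exact mulVec_injective_of_isUnit hK (by simpa [ha, hy] using heq)

variable {ι : Type*} {b : Module.Basis ι ℝ (m → ℝ)} {σ : ι → ℝ}

theorem hasDerivAt_repr {V : Type*} [NormedAddCommGroup V] [NormedSpace ℝ V]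
    [FiniteDimensional ℝ V] (b : Module.Basis ι ℝ V) {x : ℝ → V} {x' : V} {t : ℝ}
    (hx : HasDerivAt x x' t) (k : ι) : HasDerivAt (fun s => b.repr (x s) k) (b.repr x' k) t :=
  (b.coord k).toContinuousLinearMap.hasFDerivAt.comp_hasDerivAt t hx

theorem IsDampedMotion.hasDerivAt_repr_velocity [DecidableEq m] (hM : IsUnit M)
    (hb : ∀ k, K *ᵥ b k = σ k • M *ᵥ b k) (h : IsDampedMotion M 0 K x y) (k : ι) (t : ℝ) :
    HasDerivAt (fun s => b.repr (y s) k) (-(σ k * b.repr (x t) k)) t := by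
  have := Module.Finite.finite_basis b
  have := Fintype.ofFinite ι
  obtain ⟨-, a, hy, heq⟩ := h t
  rw [zero_mulVec, add_zero] at heq
  have ha : a = -∑ l, (σ l * b.repr (x t) l) • b l := by
    refine mulVec_injective_of_isUnit hM ?_
    calc M *ᵥ a = -(K *ᵥ ∑ l, b.repr (x t) l • b l) := by
          rw [b.sum_repr, eq_neg_of_add_eq_zero_left heq]
      _ = M *ᵥ -∑ l, (σ l * b.repr (x t) l) • b l := by
          simp only [mulVec_neg, mulVec_sum, mulVec_smul, hb, smul_smul, mul_comm]
  refine (hasDerivAt_repr b hy k).congr_deriv ?_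
  rw [ha, map_neg, Finsupp.neg_apply, b.repr_sum_self]

theorem IsDampedMotion.repr_velocity_smul_mulVec_eq_zero [DecidableEq m]
    {p : Type*} [Finite p] {S : Matrix p m ℝ} (hM : IsUnit M) (hσ : Function.Injective σ)
    (hb : ∀ k, K *ᵥ b k = σ k • M *ᵥ b k) (h : IsDampedMotion M 0 K x y)
    (hS : ∀ t, S *ᵥ y t = 0) (k : ι) (t : ℝ) : b.repr (y t) k • S *ᵥ b k = 0 := by
  have := Module.Finite.finite_basis b
  have := Fintype.ofFinite ι
  have := Fintype.ofFinite p
  refine eq_zero_of_forall_sum_harmonic_eq_zero hσ (s := Finset.univ)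
    (f := fun l s => b.repr (y s) l • S *ᵥ b l)
    (g := fun l s => -(σ l * b.repr (x s) l) • S *ᵥ b l)
    (fun l s => (h.hasDerivAt_repr_velocity hM hb l s).smul_const _)
    (fun l s => (((hasDerivAt_repr b (h s).1 l).const_mul (σ l)).neg.smul_const _).congr_deriv
      (by module)) (fun s => ?_) k (Finset.mem_univ k) t
  calc ∑ l, b.repr (y s) l • S *ᵥ b l = S *ᵥ ∑ l, b.repr (y s) l • b l := by
        simp only [mulVec_sum, mulVec_smul]
    _ = 0 := by rw [b.sum_repr, hS]

/-- Synchrony is decided mode by mode: applied to `x i - x j`, observability of the modes turns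
`D i j (ẋ i - ẋ j) = 0` into one scalar condition per mode `b k`. -/
theorem eq_of_undissipated_coupling [DecidableEq m] {κ : Type*}
    {D : κ → κ → Matrix m m ℝ} (hM : IsUnit M) (hK : IsUnit K) (hσ : Function.Injective σ)
    (hb : ∀ k, K *ᵥ b k = σ k • M *ᵥ b k)
    (hmode : ∀ k (c : κ → ℝ), (∀ i j, (c i - c j) • D i j *ᵥ b k = 0) → ∀ i j, c i = c j)
    {x y : κ → ℝ → m → ℝ} (h : ∀ i, IsDampedMotion M 0 K (x i) (y i))
    (hD : ∀ i j t, D i j *ᵥ (y i t - y j t) = 0) (i j : κ) (t : ℝ) : x i t = x j t := by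
  have hvelocity (t : ℝ) : y i t = y j t := by
    refine b.ext_elem fun k => hmode k (fun i => b.repr (y i t) k) (fun i j => ?_) i j
    simpa only [map_sub, Finsupp.sub_apply] using
      ((h i).sub (h j)).repr_velocity_smul_mulVec_eq_zero hM hσ hb (hD i j) k t
  exact sub_eq_zero.mp <| ((h i).sub (h j)).eq_zero_of_velocity_eq_zero hK
    (fun t => sub_eq_zero.mpr (hvelocity t)) t

theorem linearIndependent_of_mulVec_eq_smul_mulVec [DecidableEq m] (hM : IsUnit M)
    (hσ : Function.Injective σ) {u : ι → m → ℝ} (hu0 : ∀ k, u k ≠ 0)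
    (hu : ∀ k, K *ᵥ u k = σ k • M *ᵥ u k) : LinearIndependent ℝ u := by
  refine Module.End.eigenvectors_linearIndependent' (M⁻¹ * K).mulVecLin σ hσ u fun k => ?_
  refine Module.End.hasEigenvector_iff.mpr ⟨Module.End.mem_eigenspace_iff.mpr ?_, hu0 k⟩
  rw [mulVecLin_apply, ← mulVec_mulVec, hu, mulVec_smul, mulVec_mulVec,
    nonsing_inv_mul _ ((isUnit_iff_isUnit_det M).mp hM), one_mulVec]

theorem pos_of_mulVec_eq_smul_mulVec (hM : M.PosDef) (hK : K.PosDef) {μ : ℝ} {u : m → ℝ}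
    (hu0 : u ≠ 0) (hu : K *ᵥ u = μ • M *ᵥ u) : 0 < μ := by
  have hpotential := hK.dotProduct_mulVec_pos hu0
  rw [hu, dotProduct_smul, smul_eq_mul] at hpotential
  exact pos_of_mul_pos_left hpotential (hM.dotProduct_mulVec_pos hu0).le

end Modes

section Laplacian

variable {q n : ℕ} {W : Fin q → Fin q → Matrix (Fin n) (Fin n) ℝ}

theorem lap_mulVec (hdiag : ∀ i, W i i = 0) (z : Fin q × Fin n → ℝ) (i : Fin q) :
    Function.curry (lap W *ᵥ z) i = ∑ j, W i j *ᵥ (z.curry i - z.curry j) := by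
  have hentry (a : Fin n) (j : Fin q) (b : Fin n) :
      lap W (i, a) (j, b) = (if i = j then ∑ l, W i l a b else 0) - W i j a b := by
    by_cases hij : i = j
    · subst hij; simp [lap, hdiag]
    · simp [lap, hij]
  ext a
  simp only [Function.curry_apply, mulVec, dotProduct, Fintype.sum_prod_type, hentry, sub_mul,
    ite_mul, zero_mul, Finset.sum_sub_distrib, Finset.sum_ite_irrel, Finset.sum_const_zero,
    Finset.sum_ite_eq, Finset.mem_univ, if_true, Finset.sum_apply, Pi.sub_apply, mul_sub,
    Finset.sum_mul]
  rw [Finset.sum_comm]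

theorem two_mul_sum_dotProduct_sum_of_antisymm {κ m : Type*} [Fintype κ] [Fintype m]
    (y : κ → m → ℝ) {F : κ → κ → m → ℝ} (hF : ∀ i j, F j i = -F i j) :
    2 * ∑ i, y i ⬝ᵥ ∑ j, F i j = ∑ i, ∑ j, (y i - y j) ⬝ᵥ F i j := by
  have hswap : ∑ i, ∑ j, y j ⬝ᵥ F i j = -∑ i, ∑ j, y i ⬝ᵥ F i j := by
    rw [Finset.sum_comm, ← Finset.sum_neg_distrib]
    simp only [← Finset.sum_neg_distrib, ← dotProduct_neg, ← hF]
  simp only [sub_dotProduct, Finset.sum_sub_distrib, hswap, dotProduct_sum]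
  ring

theorem two_mul_dotProduct_lap_mulVec (hsymm : ∀ i j, W i j = W j i) (hdiag : ∀ i, W i i = 0)
    (z : Fin q × Fin n → ℝ) :
    2 * (z ⬝ᵥ lap W *ᵥ z) =
      ∑ i, ∑ j, (z.curry i - z.curry j) ⬝ᵥ W i j *ᵥ (z.curry i - z.curry j) := by
  rw [← two_mul_sum_dotProduct_sum_of_antisymm _
    fun i j => by rw [hsymm j i, ← mulVec_neg, neg_sub]]
  simp only [← lap_mulVec hdiag]
  rw [dotProduct, Fintype.sum_prod_type]
  rfl

theorem isHermitian_lap (hW : ∀ i j, (W i j).IsHermitian) (hsymm : ∀ i j, W i j = W j i) :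
    (lap W).IsHermitian := by
  ext ⟨i, a⟩ ⟨j, b⟩
  by_cases hij : i = j
  · subst hij
    simpa [lap] using Finset.sum_congr rfl fun l _ => (hW i l).apply a b
  · simpa [lap, hij, Ne.symm hij, hsymm j i] using (hW i j).apply a b

theorem posSemidef_lap (hW : ∀ i j, (W i j).PosSemidef) (hsymm : ∀ i j, W i j = W j i)
    (hdiag : ∀ i, W i i = 0) : (lap W).PosSemidef := by
  refine .of_dotProduct_mulVec_nonneg (isHermitian_lap (fun i j => (hW i j).1) hsymm) fun z => ?_
  refine nonneg_of_mul_nonneg_right ?_ two_pos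
  rw [star_trivial, two_mul_dotProduct_lap_mulVec hsymm hdiag]
  exact Finset.sum_nonneg fun i _ => Finset.sum_nonneg fun j _ =>
    (hW i j).dotProduct_mulVec_nonneg _

theorem lap_mulVec_eq_zero_iff (hW : ∀ i j, (W i j).PosSemidef) (hsymm : ∀ i j, W i j = W j i)
    (hdiag : ∀ i, W i i = 0) {z : Fin q × Fin n → ℝ} :
    lap W *ᵥ z = 0 ↔ ∀ i j, W i j *ᵥ (z.curry i - z.curry j) = 0 := by
  have hterm (i j : Fin q) : 0 ≤ (z.curry i - z.curry j) ⬝ᵥ W i j *ᵥ (z.curry i - z.curry j) :=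
    (hW i j).dotProduct_mulVec_nonneg _
  rw [← (posSemidef_lap hW hsymm hdiag).dotProduct_mulVec_zero_iff, star_trivial,
    ← mul_eq_zero_iff_left two_ne_zero, two_mul_dotProduct_lap_mulVec hsymm hdiag,
    Finset.sum_eq_zero_iff_of_nonneg fun i _ => Finset.sum_nonneg fun j _ => hterm i j]
  simp only [Finset.mem_univ, true_imp_iff,
    Finset.sum_eq_zero_iff_of_nonneg fun j _ => hterm _ j,
    ← (hW _ _).dotProduct_mulVec_zero_iff, star_trivial]

/-- The matrix `I_q ⊗ v` with the trivial index of the column `v` dropped. It embeds the amplitudes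
of the mode shape `v` into the configuration space of the array, and congruence by it turns a
Laplacian into its projection. -/
def modeInclusion (q : ℕ) (v : Fin n → ℝ) : Matrix (Fin q × Fin n) (Fin q) ℝ :=
  ((1 : Matrix (Fin q) (Fin q) ℝ) ⊗ₖ replicateCol Unit v).submatrix id fun i => (i, ())

theorem modeInclusion_mulVec (v : Fin n → ℝ) (x : Fin q → ℝ) :
    modeInclusion q v *ᵥ x = fun p => x p.1 * v p.2 := by
  ext p
  simp [modeInclusion, mulVec, dotProduct, one_apply, mul_comm]

theorem projectedLaplacian_eq_conjTranspose_mul_mul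
    (L : Matrix (Fin q × Fin n) (Fin q × Fin n) ℝ) (v : Fin n → ℝ) :
    projectedLaplacian L v = (modeInclusion q v)ᴴ * L * modeInclusion q v := by
  rw [projectedLaplacian, modeInclusion, conjTranspose_submatrix, conjTranspose_kronecker,
    conjTranspose_one, conjTranspose_replicateCol, star_trivial]
  rfl

theorem posSemidef_projectedLaplacian {L : Matrix (Fin q × Fin n) (Fin q × Fin n) ℝ}
    (hL : L.PosSemidef) (v : Fin n → ℝ) : (projectedLaplacian L v).PosSemidef := by
  rw [projectedLaplacian_eq_conjTranspose_mul_mul]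
  exact hL.conjTranspose_mul_mul_same _

theorem projectedLaplacian_mulVec_eq_zero_iff {L : Matrix (Fin q × Fin n) (Fin q × Fin n) ℝ}
    (hL : L.PosSemidef) {v : Fin n → ℝ} {x : Fin q → ℝ} :
    projectedLaplacian L v *ᵥ x = 0 ↔ L *ᵥ (fun p => x p.1 * v p.2) = 0 := by
  rw [← (posSemidef_projectedLaplacian hL v).dotProduct_mulVec_zero_iff,
    ← hL.dotProduct_mulVec_zero_iff, ← modeInclusion_mulVec, star_mulVec,
    projectedLaplacian_eq_conjTranspose_mul_mul, ← mulVec_mulVec, ← mulVec_mulVec,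
    dotProduct_mulVec (star x)]

theorem projectedLaplacian_lap_mulVec_eq_zero_iff (hW : ∀ i j, (W i j).PosSemidef)
    (hsymm : ∀ i j, W i j = W j i) (hdiag : ∀ i, W i i = 0) {v : Fin n → ℝ} {x : Fin q → ℝ} :
    projectedLaplacian (lap W) v *ᵥ x = 0 ↔ ∀ i j, (x i - x j) • W i j *ᵥ v = 0 := by
  rw [projectedLaplacian_mulVec_eq_zero_iff (posSemidef_lap hW hsymm hdiag),
    lap_mulVec_eq_zero_iff hW hsymm hdiag]
  refine forall₂_congr fun i j => ?_
  rw [← mulVec_smul, sub_smul]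
  rfl

end Laplacian

section Array

theorem curry_one_kronecker_mulVec {κ m : Type*} [Fintype κ] [DecidableEq κ] [Fintype m]
    (A : Matrix m m ℝ) (z : κ × m → ℝ) (i : κ) :
    Function.curry (((1 : Matrix κ κ ℝ) ⊗ₖ A) *ᵥ z) i = A *ᵥ z.curry i := by
  ext a
  simp [mulVec, dotProduct, Fintype.sum_prod_type, one_apply, ite_mul, Finset.sum_ite_irrel]

theorem IsDampedMotion.curry {κ m : Type*} [Fintype κ] [DecidableEq κ] [Fintype m]
    {M K : Matrix m m ℝ} {x y : ℝ → κ × m → ℝ}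
    (h : IsDampedMotion ((1 : Matrix κ κ ℝ) ⊗ₖ M) 0 ((1 : Matrix κ κ ℝ) ⊗ₖ K) x y) (i : κ) :
    IsDampedMotion M 0 K (fun t => (x t).curry i) fun t => (y t).curry i := by
  intro t
  obtain ⟨hx, a, hy, heq⟩ := h t
  refine ⟨hasDerivAt_pi.mpr fun k => hasDerivAt_pi.mp hx (i, k), Function.curry a i,
    hasDerivAt_pi.mpr fun k => hasDerivAt_pi.mp hy (i, k), ?_⟩
  rw [zero_mulVec, add_zero] at heq ⊢
  rw [← curry_one_kronecker_mulVec, ← curry_one_kronecker_mulVec]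
  exact congrArg (fun z => Function.curry z i) heq

theorem eq_of_periodic_of_tendsto {α : Type*} [TopologicalSpace α] [T2Space α] {f : ℝ → α}
    {T : ℝ} (hf : Function.Periodic f T) (hT : 0 < T) {a : α} (ha : Tendsto f atTop (𝓝 a))
    (t : ℝ) : f t = a := by
  have hsample : Tendsto (fun k : ℕ => t + k * T) atTop atTop :=
    tendsto_atTop_add_const_left _ t (tendsto_natCast_atTop_atTop.atTop_mul_const hT)
  refine tendsto_nhds_unique tendsto_const_nhds ((ha.comp hsample).congr fun k => ?_)
  exact hf.nat_mul k t

variable {q n : ℕ} {M K : Matrix (Fin n) (Fin n) ℝ} {D : Fin q → Fin q → Matrix (Fin n) (Fin n) ℝ}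

theorem IsSolution.exists_isDampedMotion (hDdiag : ∀ i, D i i = 0)
    {x : Fin q → ℝ → Fin n → ℝ} (h : IsSolution M K D x) :
    ∃ y, IsDampedMotion ((1 : Matrix (Fin q) (Fin q) ℝ) ⊗ₖ M) (lap D)
      ((1 : Matrix (Fin q) (Fin q) ℝ) ⊗ₖ K) (fun t p => x p.1 t p.2) y := by
  obtain ⟨y, a, h⟩ := h
  refine ⟨fun t p => y p.1 t p.2, fun t =>
    ⟨hasDerivAt_pi.mpr fun p => hasDerivAt_pi.mp (h p.1 t).1 p.2, fun p => a p.1 t p.2,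
      hasDerivAt_pi.mpr fun p => hasDerivAt_pi.mp (h p.1 t).2.1 p.2, ?_⟩⟩
  refine Function.curry_injective (funext fun i => ?_)
  have hforce := lap_mulVec hDdiag (fun p => y p.1 t p.2) i
  have hinertia := curry_one_kronecker_mulVec M (fun p : Fin q × Fin n => a p.1 t p.2) i
  have hstiffness := curry_one_kronecker_mulVec K (fun p : Fin q × Fin n => x p.1 t p.2) i
  refine Eq.trans ?_ (h i t).2.2
  rw [add_right_comm]
  exact congrArg₂ (· + ·) (congrArg₂ (· + ·) hinertia hstiffness) hforce

theorem isSolution_cos_smul {ω : ℝ} {u : Fin n → ℝ} (hu : K *ᵥ u = ω ^ 2 • M *ᵥ u)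
    {c : Fin q → ℝ} (hc : ∀ i j, (c i - c j) • D i j *ᵥ u = 0) :
    IsSolution M K D fun i t => (c i * Real.cos (ω * t)) • u := by
  have hphase (t : ℝ) : HasDerivAt (ω * ·) ω t := by
    simpa using (hasDerivAt_id t).const_mul ω
  refine ⟨fun i t => (c i * (-Real.sin (ω * t) * ω)) • u,
    fun i t => (c i * (-(Real.cos (ω * t) * ω) * ω)) • u, fun i t =>
    ⟨((hphase t).cos.const_mul (c i)).smul_const _,
      (((hphase t).sin.neg.mul_const ω).const_mul (c i)).smul_const _, ?_⟩⟩
  have hcoupling : ∑ j, D i j *ᵥ ((c i * (-Real.sin (ω * t) * ω)) • u -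
      (c j * (-Real.sin (ω * t) * ω)) • u) = 0 := by
    refine Finset.sum_eq_zero fun j _ => ?_
    rw [← sub_smul, ← sub_mul, mul_comm, mul_smul, mulVec_smul, mulVec_smul, hc, smul_zero]
  rw [hcoupling, mulVec_smul, mulVec_smul, hu]
  module

theorem synchronizes_iff_forall_tendsto_sub : Synchronizes M K D ↔
    ∀ x, IsSolution M K D x → ∀ i j, Tendsto (fun t => x i t - x j t) atTop (𝓝 0) := by
  refine forall₂_congr fun x _ => forall₂_congr fun i j => ?_
  rw [← tendsto_zero_iff_norm_tendsto_zero]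
  exact ((PiLp.homeomorph 2 fun _ : Fin n => ℝ).symm.isInducing.tendsto_nhds_iff (y := 0)).symm

theorem Synchronizes.eq_of_mode (hsync : Synchronizes M K D) {μ : ℝ} (hμ : 0 < μ)
    {u : Fin n → ℝ} (hu0 : u ≠ 0) (hu : K *ᵥ u = μ • M *ᵥ u) {c : Fin q → ℝ}
    (hc : ∀ i j, (c i - c j) • D i j *ᵥ u = 0) (i j : Fin q) : c i = c j := by
  have hω : 0 < √μ := Real.sqrt_pos.mpr hμ
  have hsol := isSolution_cos_smul (ω := √μ) (by rwa [Real.sq_sqrt hμ.le]) hc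
  have hperiodic : Function.Periodic
      (fun t => (c i * Real.cos (√μ * t)) • u - (c j * Real.cos (√μ * t)) • u)
      (2 * Real.pi / √μ) := fun t => by
    simp only [mul_add, mul_div_cancel₀ _ hω.ne', Real.cos_add_two_pi]
  have hzero := eq_of_periodic_of_tendsto hperiodic (by positivity)
    (synchronizes_iff_forall_tendsto_sub.mp hsync _ hsol i j) 0
  simpa [← sub_smul, sub_eq_zero, hu0] using hzero

theorem synchronizes_of_forall_mode (hM : M.PosDef) (hK : K.PosDef)
    (hD : ∀ i j, (D i j).PosSemidef) (hDsymm : ∀ i j, D i j = D j i) (hDdiag : ∀ i, D i i = 0)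
    {ι : Type*} {σ : ι → ℝ} (hσ : Function.Injective σ) {b : Module.Basis ι ℝ (Fin n → ℝ)}
    (hb : ∀ k, K *ᵥ b k = σ k • M *ᵥ b k)
    (hmode : ∀ k (c : Fin q → ℝ), (∀ i j, (c i - c j) • D i j *ᵥ b k = 0) →
      ∀ i j, c i = c j) : Synchronizes M K D := by
  refine synchronizes_iff_forall_tendsto_sub.mpr fun x hx i j => ?_
  obtain ⟨y, hmotion⟩ := hx.exists_isDampedMotion hDdiag
  refine tendsto_of_forall_undissipated (PosDef.one.kronecker hM) (PosDef.one.kronecker hK)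
    (posSemidef_lap hD hDsymm hDdiag) (Φ := fun z => z.curry i - z.curry j)
    (by unfold Function.curry; fun_prop) (fun x y h hy => ?_) hmotion
  simp only [lap_mulVec_eq_zero_iff hD hDsymm hDdiag] at hy
  exact sub_eq_zero.mpr <| eq_of_undissipated_coupling hM.isUnit hK.isUnit hσ hb hmode h.curry
    (fun i j t => hy t i j) i j 0

theorem synchronizes_iff_forall_mode (hM : M.PosDef) (hK : K.PosDef)
    (hD : ∀ i j, (D i j).PosSemidef) (hDsymm : ∀ i j, D i j = D j i) (hDdiag : ∀ i, D i i = 0)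
    {σ : Fin n → ℝ} (hσ : Function.Injective σ) {u : Fin n → Fin n → ℝ} (hu0 : ∀ k, u k ≠ 0)
    (hu : ∀ k, K *ᵥ u k = σ k • M *ᵥ u k) :
    Synchronizes M K D ↔ ∀ k (c : Fin q → ℝ),
      (∀ i j, (c i - c j) • D i j *ᵥ u k = 0) → ∀ i j, c i = c j := by
  have hσ_pos (k : Fin n) : 0 < σ k := pos_of_mulVec_eq_smul_mulVec hM hK (hu0 k) (hu k)
  refine ⟨fun hsync k c hc => hsync.eq_of_mode (hσ_pos k) (hu0 k) (hu k) hc, fun hmode => ?_⟩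
  have hli := linearIndependent_of_mulVec_eq_smul_mulVec hM.isUnit hσ hu0 hu
  let b := basisOfLinearIndependentOfCardEqFinrank' u hli (by simp)
  have hb : ⇑b = u := coe_basisOfLinearIndependentOfCardEqFinrank' u hli _
  exact synchronizes_of_forall_mode hM hK hD hDsymm hDdiag hσ (b := b)
    (by simpa only [hb] using hu) (by simpa only [hb] using hmode)

end Array

section SecondEigenvalue

variable {κ : Type*} [Fintype κ] [DecidableEq κ] {G : Matrix κ κ ℝ}

theorem rootMultiplicity_zero_charpoly_eq_finrank_ker (hG : G.IsHermitian) :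
    G.charpoly.rootMultiplicity 0 = Module.finrank ℝ (LinearMap.ker G.mulVecLin) := by
  have hmult : G.charpoly.rootMultiplicity 0 = Fintype.card {i // hG.eigenvalues i = 0} := by
    rw [← Polynomial.count_roots, hG.roots_charpoly_eq_eigenvalues, Multiset.count_map,
      Fintype.card_subtype, Finset.card_def, Finset.filter_val]
    simp [eq_comm]
  have hcard : Fintype.card {i // hG.eigenvalues i = 0} + G.rank = Fintype.card κ := by
    rw [hG.rank_eq_card_non_zero_eigs, Fintype.card_subtype_compl]
    exact Nat.add_sub_cancel' (Fintype.card_subtype_le _)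
  have hrank : G.rank + Module.finrank ℝ (LinearMap.ker G.mulVecLin) = Fintype.card κ :=
    (LinearMap.finrank_range_add_finrank_ker G.mulVecLin).trans <|
      Module.finrank_fintype_fun_eq_card ℝ
  omega

theorem rootMultiplicity_zero_charpoly_eq_one_iff (hG : G.IsHermitian) {u : κ → ℝ} (hu : u ≠ 0)
    (hGu : G *ᵥ u = 0) :
    G.charpoly.rootMultiplicity 0 = 1 ↔ ∀ x, G *ᵥ x = 0 → ∃ a : ℝ, a • u = x := by
  rw [rootMultiplicity_zero_charpoly_eq_finrank_ker hG,
    finrank_eq_one_iff_of_nonzero' (⟨u, by simpa using hGu⟩ : LinearMap.ker G.mulVecLin)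
      (by simpa [Subtype.ext_iff] using hu)]
  simp [Subtype.ext_iff]

theorem rootMultiplicity_zero_charpoly_eq_one_iff_forall_const [Nonempty κ]
    (hG : G.IsHermitian) (hG1 : G *ᵥ 1 = 0) :
    G.charpoly.rootMultiplicity 0 = 1 ↔ ∀ x, G *ᵥ x = 0 → ∀ i j, x i = x j := by
  rw [rootMultiplicity_zero_charpoly_eq_one_iff hG one_ne_zero hG1]
  refine forall₂_congr fun x _ => ⟨?_, fun hx => ?_⟩
  · rintro ⟨a, rfl⟩ _ _
    rfl
  · obtain ⟨i⟩ := ‹Nonempty κ›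
    exact ⟨x i, funext fun j => by simp [hx i j]⟩

theorem lt_getElem_one_iff_count_eq_one {α : Type*} [LinearOrder α] {l : List α}
    (hl : l.Pairwise (· ≤ ·)) {a : α} (ha : a ∈ l) (hle : ∀ x ∈ l, a ≤ x) (h1 : 1 < l.length) :
    a < l[1] ↔ l.count a = 1 := by
  match l, h1 with
  | b :: c :: l, h1 =>
    obtain ⟨hb, hc⟩ := List.pairwise_cons.mp hl
    obtain rfl : b = a := le_antisymm
      ((List.mem_cons.mp ha).elim (fun h => h.ge) (hb a)) (hle b List.mem_cons_self)
    have hmem : b ∈ c :: l ↔ b = c := by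
      refine ⟨fun h => le_antisymm (hb c List.mem_cons_self) ?_, fun h => h ▸ List.mem_cons_self⟩
      exact (List.mem_cons.mp h).elim (fun h => h.ge) ((List.pairwise_cons.mp hc).1 b)
    rw [List.count_cons_self, Nat.add_eq_right, List.count_eq_zero, hmem]
    exact (hb c List.mem_cons_self).lt_iff_ne

theorem map_re_roots_charpoly_map_ofReal (hG : G.IsHermitian) :
    (G.map Complex.ofReal).charpoly.roots.map Complex.re = G.charpoly.roots := by
  have hmap : (G.map Complex.ofReal).charpoly = G.charpoly.map Complex.ofRealHom :=
    G.charpoly_map Complex.ofRealHom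
  rw [hmap, hG.splits_charpoly.roots_map, Multiset.map_map]
  simp

theorem reEigenvalue_one_pos_iff {q : ℕ} (hq : 2 ≤ q) {G : Matrix (Fin q) (Fin q) ℝ}
    (hG : G.PosSemidef) (hdet : G.det = 0) :
    0 < reEigenvalue (G.map Complex.ofReal) ⟨1, hq⟩ ↔ G.charpoly.rootMultiplicity 0 = 1 := by
  have hroots := map_re_roots_charpoly_map_ofReal hG.1
  have hmem : 0 ∈ G.charpoly.roots :=
    (Polynomial.mem_roots (charpoly_monic G).ne_zero).mpr <| by
      simp [Polynomial.IsRoot, eval_charpoly, det_neg, hdet]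
  have hnonneg : ∀ x ∈ G.charpoly.roots, 0 ≤ x := by
    rw [hG.1.roots_charpoly_eq_eigenvalues]
    simpa using hG.eigenvalues_nonneg
  rw [← Polynomial.count_roots, ← hroots, ← Multiset.sort_eq
    ((G.map Complex.ofReal).charpoly.roots.map Complex.re) (· ≤ ·), Multiset.coe_count]
  refine lt_getElem_one_iff_count_eq_one (Multiset.pairwise_sort _ _) ?_ ?_ _
  · rwa [Multiset.mem_sort, hroots]
  · simpa only [Multiset.mem_sort, hroots] using hnonneg

end SecondEigenvalue

section InverseSqrt

variable {q n : ℕ} {M K : Matrix (Fin n) (Fin n) ℝ}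

theorem posDef_invSqrt (hM : M.PosDef) : (invSqrt M).PosDef := by
  refine PosDef.inv ?_
  rw [(nonneg_iff_posSemidef.mp (CFC.sqrt_nonneg M)).posDef_iff_isUnit,
    CFC.isUnit_sqrt_iff M hM.posSemidef.nonneg]
  exact hM.isUnit

theorem invSqrt_mul_self (hM : M.PosDef) : invSqrt M * invSqrt M = M⁻¹ := by
  rw [invSqrt, ← Matrix.mul_inv_rev, CFC.sqrt_mul_sqrt_self M hM.posSemidef.nonneg]

theorem invSqrt_mul_mul_invSqrt (hM : M.PosDef) : invSqrt M * (M * invSqrt M) = 1 := by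
  rw [mul_eq_one_comm, mul_assoc, invSqrt_mul_self hM]
  exact mul_nonsing_inv _ ((isUnit_iff_isUnit_det M).mp hM.isUnit)

theorem mulVec_invSqrt_mulVec_eq_smul (hM : M.PosDef) {μ : ℝ} {v : Fin n → ℝ}
    (hv : normalizedStiffness M K *ᵥ v = μ • v) :
    K *ᵥ (invSqrt M *ᵥ v) = μ • M *ᵥ (invSqrt M *ᵥ v) := by
  refine mulVec_injective_of_isUnit (posDef_invSqrt hM).isUnit ?_
  simpa only [mulVec_smul, mulVec_mulVec, invSqrt_mul_mul_invSqrt hM, one_mulVec,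
    normalizedStiffness, mul_assoc] using hv

variable {D : Fin q → Fin q → Matrix (Fin n) (Fin n) ℝ}

theorem posSemidef_invSqrt_mul_mul_invSqrt (hM : M.PosDef) {A : Matrix (Fin n) (Fin n) ℝ}
    (hA : A.PosSemidef) : (invSqrt M * A * invSqrt M).PosSemidef := by
  simpa only [(posDef_invSqrt hM).1.eq] using hA.conjTranspose_mul_mul_same (invSqrt M)

theorem posSemidef_dissipativeLaplacian (hM : M.PosDef) (hD : ∀ i j, (D i j).PosSemidef)
    (hDsymm : ∀ i j, D i j = D j i) (hDdiag : ∀ i, D i i = 0) :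
    (dissipativeLaplacian M D).PosSemidef :=
  posSemidef_lap (fun i j => posSemidef_invSqrt_mul_mul_invSqrt hM (hD i j))
    (fun i j => by rw [hDsymm]) fun i => by rw [hDdiag, mul_zero, zero_mul]

theorem projectedLaplacian_dissipativeLaplacian_mulVec_eq_zero_iff (hM : M.PosDef)
    (hD : ∀ i j, (D i j).PosSemidef) (hDsymm : ∀ i j, D i j = D j i) (hDdiag : ∀ i, D i i = 0)
    {v : Fin n → ℝ} {x : Fin q → ℝ} :
    projectedLaplacian (dissipativeLaplacian M D) v *ᵥ x = 0 ↔
      ∀ i j, (x i - x j) • D i j *ᵥ (invSqrt M *ᵥ v) = 0 := by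
  rw [dissipativeLaplacian, projectedLaplacian_lap_mulVec_eq_zero_iff
    (fun i j => posSemidef_invSqrt_mul_mul_invSqrt hM (hD i j)) (fun i j => by rw [hDsymm])
    fun i => by rw [hDdiag, mul_zero, zero_mul]]
  refine forall₂_congr fun i j => ?_
  simp only [mul_assoc, ← mulVec_mulVec, ← mulVec_smul _ _ (D i j *ᵥ _)]
  exact (mulVec_injective_of_isUnit (posDef_invSqrt hM).isUnit).eq_iff' (mulVec_zero _)

end InverseSqrt

end SmallOscillations

open SmallOscillations

theorem mainTheorem3 {q n : ℕ} (hq : 1 ≤ q)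
    (M K : Matrix (Fin n) (Fin n) ℝ) (hM : M.PosDef) (hK : K.PosDef)
    (D : Fin q → Fin q → Matrix (Fin n) (Fin n) ℝ)
    (hD : ∀ i j, (D i j).PosSemidef) (hDsymm : ∀ i j, D i j = D j i) (hDdiag : ∀ i, D i i = 0)
    (σ : Fin n → ℝ) (hσ : Function.Injective σ)
    (v : Fin n → Fin n → ℝ) (hv_unit : ∀ k, v k ⬝ᵥ v k = 1)
    (hv : ∀ k, SmallOscillations.normalizedStiffness M K *ᵥ v k = σ k • v k)
    (G : Fin n → Matrix (Fin q) (Fin q) ℝ)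
    (hG : ∀ k, G k = SmallOscillations.projectedLaplacian
      (SmallOscillations.dissipativeLaplacian M D) (v k)) :
    (SmallOscillations.Synchronizes M K D ↔
      ∀ k, (G k).charpoly.rootMultiplicity 0 = 1) ∧
    (∀ hq2 : 2 ≤ q, SmallOscillations.Synchronizes M K D ↔
      ∀ k, 0 < SmallOscillations.reEigenvalue ((G k).map Complex.ofReal) ⟨1, hq2⟩) := by
  have : Nonempty (Fin q) := ⟨⟨0, hq⟩⟩
  have hmode_ne (k : Fin n) : invSqrt M *ᵥ v k ≠ 0 := fun h => by
    have hvk : v k = 0 := Matrix.mulVec_injective_of_isUnit (posDef_invSqrt hM).isUnit (by simpa)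
    simpa [hvk] using hv_unit k
  have hpsd (k : Fin n) : (G k).PosSemidef :=
    hG k ▸ posSemidef_projectedLaplacian (posSemidef_dissipativeLaplacian hM hD hDsymm hDdiag) _
  have hker (k : Fin n) (x : Fin q → ℝ) :
      G k *ᵥ x = 0 ↔ ∀ i j, (x i - x j) • D i j *ᵥ (invSqrt M *ᵥ v k) = 0 :=
    hG k ▸ projectedLaplacian_dissipativeLaplacian_mulVec_eq_zero_iff hM hD hDsymm hDdiag
  have hone (k : Fin n) : G k *ᵥ 1 = 0 := (hker k 1).mpr (by simp)
  have hsimple : Synchronizes M K D ↔ ∀ k, (G k).charpoly.rootMultiplicity 0 = 1 := by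
    simp only [fun k => rootMultiplicity_zero_charpoly_eq_one_iff_forall_const (hpsd k).1 (hone k),
      hker]
    exact synchronizes_iff_forall_mode hM hK hD hDsymm hDdiag hσ hmode_ne
      fun k => mulVec_invSqrt_mulVec_eq_smul hM (hv k)
  refine ⟨hsimple, fun hq2 => hsimple.trans (forall_congr' fun k => ?_)⟩
  exact (reEigenvalue_one_pos_iff hq2 (hpsd k)
    (Matrix.exists_mulVec_eq_zero_iff.mp ⟨1, one_ne_zero, hone k⟩)).symm
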